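/- \textbf{Conventions.} A metric space is proper if all its closed balls are compact. A map $f\colon X\to Y$ of metric spaces is \emph{asymptotically Lipschitz} if there are $\lambda,\varepsilon>0$ with $d(f(x),f(x'))\le\lambda d(x,x')+\varepsilon$ for all $x,x'\in X$; it is \emph{proper} if it is continuous and preimages of compact sets are compact. For a metric space $L$ of diameter $\le 1$, the \emph{open cone} $\mathcal OL$ is the set $(L\times[0,\infty))/(L\times\{0\})$ with the metric $$d([x_1,t_1],[x_2,t_2])=|t_1-t_2|+\min\{t_1,t_2\}\,d(x_1,x_2).$$ Let $\mathcal L$ be the class of compact absolute Lipschitz neighborhood euclidean extensors (ALNERs) of diameter $\le 1$, that is, of the compact metric spaces $L$ of diameter $\le 1$ that are bi-Lipschitz equivalent to a subset of some $\mathbb R^n$ and have the following property: for every $m$ and every closed $A\subset\mathbb R^m$, each Lipschitz map $A\to L$ has a Lipschitz extension $U\to L$ to some open neighborhood $U$ of $A$ in $\mathbb R^m$. For a proper metric space $X$ and $L\in\mathcal L$ we write $\operatorname{aed}X\le[\mathcal OL]$ if for every closed subset $A\subset X$, every proper asymptotically Lipschitz map $A\to\mathcal OL$ has a proper asymptotically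 Lipschitz extension $X\to\mathcal OL$. \textbf{Corollary (Finite Sum Theorem).} Let $X$ be a proper metric space, $X=X_1\cup X_2$, where $X_1$ and $X_2$ are closed subsets of $X$ (with the induced metrics), and let $L\in\mathcal L$. If $\operatorname{aed}X_1\le[\mathcal OL]$ and $\operatorname{aed}X_2\le[\mathcal OL]$, then $\operatorname{aed}X\le[\mathcal OL]$. -/

import Mathlib

open scoped NNReal

/-- A metric space of diameter at most `1`. -/
class DiamLEOne (L : Type*) [MetricSpace L] : Prop where
  dist_le_one : ∀ x y : L, dist x y ≤ 1

/-- The equivalence relation on `L × ℝ₊` that collapses `L × {0}` to a point. -/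
def coneSetoid (L : Type*) : Setoid (L × ℝ≥0) where
  r p q := p = q ∨ (p.2 = 0 ∧ q.2 = 0)
  iseqv :=
    { refl := fun _ => Or.inl rfl
      symm := by
        rintro p q (rfl | ⟨h, h'⟩)
        · exact Or.inl rfl
        · exact Or.inr ⟨h', h⟩
      trans := by
        rintro p q r (rfl | ⟨h, h'⟩) (rfl | ⟨k, k'⟩)
        · exact Or.inl rfl
        · exact Or.inr ⟨k, k'⟩
        · exact Or.inr ⟨h, h'⟩
        · exact Or.inr ⟨h, k'⟩ }

/-- The open cone `(L × ℝ₊) / (L × {0})`. -/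
def OpenCone (L : Type*) : Type _ := Quotient (coneSetoid L)

/-- The function `|t₁ - t₂| + min t₁ t₂ * d(x₁, x₂)` on `L × ℝ₊`. -/
noncomputable def preConeDist {L : Type*} [MetricSpace L] (p q : L × ℝ≥0) : ℝ :=
  |(p.2 : ℝ) - q.2| + min (p.2 : ℝ) q.2 * dist p.1 q.1

/-- The distance on the open cone. -/
noncomputable def coneDist {L : Type*} [MetricSpace L] : OpenCone L → OpenCone L → ℝ :=
  Quotient.lift₂ preConeDist (by
    rintro p q p' q' (rfl | ⟨h, h'⟩) (rfl | ⟨k, k'⟩) <;> simp [preConeDist, *])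

theorem preConeDist_self {L : Type*} [MetricSpace L] (p : L × ℝ≥0) :
    preConeDist p p = 0 := by
  simp [preConeDist]

theorem preConeDist_comm {L : Type*} [MetricSpace L] (p q : L × ℝ≥0) :
    preConeDist p q = preConeDist q p := by
  simp only [preConeDist, abs_sub_comm (p.2 : ℝ), min_comm (p.2 : ℝ), dist_comm p.1]

theorem preConeDist_triangle {L : Type*} [MetricSpace L] [DiamLEOne L] (p q r : L × ℝ≥0) :
    preConeDist p r ≤ preConeDist p q + preConeDist q r := by
  obtain ⟨x, t⟩ := p
  obtain ⟨y, s⟩ := q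
  obtain ⟨z, u⟩ := r
  have h := dist_triangle x y z
  have h1 := DiamLEOne.dist_le_one x z
  have hxy : 0 ≤ dist x y := dist_nonneg
  have hyz : 0 ≤ dist y z := dist_nonneg
  have hxz : 0 ≤ dist x z := dist_nonneg
  have ht := t.coe_nonneg
  have hs := s.coe_nonneg
  have hu := u.coe_nonneg
  simp only [preConeDist]
  generalize (t : ℝ) = t at *
  generalize (s : ℝ) = s at *
  generalize (u : ℝ) = u at *
  rcases le_total (min t u) s with hm | hm
  · have e1 : min t u * dist x y ≤ min t s * dist x y :=
      mul_le_mul_of_nonneg_right (le_min (min_le_left _ _) hm) hxy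
    have e2 : min t u * dist y z ≤ min s u * dist y z :=
      mul_le_mul_of_nonneg_right (le_min hm (min_le_right _ _)) hyz
    have e3 : min t u * dist x z ≤ min t u * (dist x y + dist y z) :=
      mul_le_mul_of_nonneg_left h (le_min ht hu)
    have e4 := abs_sub_le t s u
    linarith
  · have hst : s ≤ t := hm.trans (min_le_left _ _)
    have hsu : s ≤ u := hm.trans (min_le_right _ _)
    rw [min_eq_right hst, min_eq_left hsu, abs_of_nonneg (sub_nonneg.2 hst),
      abs_of_nonpos (sub_nonpos.2 hsu)]
    have e1 : (min t u - s) * dist x z ≤ (min t u - s) * 1 :=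
      mul_le_mul_of_nonneg_left h1 (sub_nonneg.2 hm)
    have e2 : s * dist x z ≤ s * (dist x y + dist y z) := mul_le_mul_of_nonneg_left h hs
    have e3 : |t - u| = t + u - 2 * min t u := by
      rcases le_total t u with h' | h'
      · rw [min_eq_left h', abs_of_nonpos (sub_nonpos.2 h')]; ring
      · rw [min_eq_right h', abs_of_nonneg (sub_nonneg.2 h')]; ring
    nlinarith

theorem rel_of_preConeDist_eq_zero {L : Type*} [MetricSpace L] (p q : L × ℝ≥0)
    (h : preConeDist p q = 0) : p = q ∨ (p.2 = 0 ∧ q.2 = 0) := by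
  obtain ⟨x, t⟩ := p
  obtain ⟨y, s⟩ := q
  simp only [preConeDist] at h
  have h1 : 0 ≤ |(t : ℝ) - s| := abs_nonneg _
  have h2 : 0 ≤ min (t : ℝ) s * dist x y :=
    mul_nonneg (le_min t.coe_nonneg s.coe_nonneg) dist_nonneg
  have h3 : |(t : ℝ) - s| = 0 := by linarith
  have h4 : min (t : ℝ) s * dist x y = 0 := by linarith
  have hts : t = s := NNReal.coe_injective (sub_eq_zero.1 (abs_eq_zero.1 h3))
  subst hts
  rw [min_self] at h4
  rcases mul_eq_zero.1 h4 with h5 | h5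
  · have : t = 0 := NNReal.coe_eq_zero.1 h5
    exact Or.inr ⟨this, this⟩
  · exact Or.inl (by rw [dist_eq_zero.1 h5])

noncomputable instance instMetricSpaceOpenCone {L : Type*} [MetricSpace L] [DiamLEOne L] :
    MetricSpace (OpenCone L) where
  dist := coneDist
  dist_self := by
    rintro ⟨p⟩
    exact preConeDist_self p
  dist_comm := by
    rintro ⟨p⟩ ⟨q⟩
    exact preConeDist_comm p q
  dist_triangle := by
    rintro ⟨p⟩ ⟨q⟩ ⟨r⟩
    exact preConeDist_triangle p q r
  eq_of_dist_eq_zero := by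
    rintro ⟨p⟩ ⟨q⟩ h
    exact Quotient.sound (rel_of_preConeDist_eq_zero p q h)

/-- `f` is asymptotically Lipschitz: `d(f x, f y) ≤ c * d(x, y) + ε` for some `c, ε > 0`. -/
def AsympLipschitz {X Y : Type*} [MetricSpace X] [MetricSpace Y] (f : X → Y) : Prop :=
  ∃ c ε : ℝ, 0 < c ∧ 0 < ε ∧ ∀ x y : X, dist (f x) (f y) ≤ c * dist x y + ε

/-- `X τ P` in the asymptotic category: every proper asymptotically Lipschitz map from a closed
subset of `X` to `P` has a proper asymptotically Lipschitz extension to `X`. -/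
def KuratowskiTau (X P : Type*) [MetricSpace X] [MetricSpace P] : Prop :=
  ∀ A : Set X, IsClosed A → ∀ f : A → P, IsProperMap f → AsympLipschitz f →
    ∃ g : X → P, IsProperMap g ∧ AsympLipschitz g ∧ ∀ a : A, g a = f a

/-- The asymptotic extension dimension of `X` does not exceed the class `[𝒪 L]`. -/
def AedLE (X L : Type*) [MetricSpace X] [MetricSpace L] [DiamLEOne L] : Prop :=
  KuratowskiTau X (OpenCone L)

/-- A compact absolute Lipschitz neighborhood euclidean extensor: a compact metric space, which
is bi-Lipschitz equivalent to a subset of some `ℝⁿ`, such that every Lipschitz map into it from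
a closed subset of some `ℝⁿ` has a Lipschitz extension to a neighborhood of that subset. -/
structure IsCompactALNER (L : Type*) [MetricSpace L] : Prop where
  compact : CompactSpace L
  embeds : ∃ (n : ℕ) (e : L → EuclideanSpace ℝ (Fin n)),
    (∃ K : ℝ≥0, LipschitzWith K e) ∧ ∃ K : ℝ≥0, AntilipschitzWith K e
  extends_nhds : ∀ (n : ℕ) (A : Set (EuclideanSpace ℝ (Fin n))), IsClosed A →
    ∀ f : A → L, (∃ K : ℝ≥0, LipschitzWith K f) →
      ∃ U : Set (EuclideanSpace ℝ (Fin n)), IsOpen U ∧ ∃ hAU : A ⊆ U,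
        ∃ g : U → L, (∃ K : ℝ≥0, LipschitzWith K g) ∧ ∀ a : A, g ⟨a, hAU a.2⟩ = f a

/-!
Maps into the open cone are extended over one closed subspace at a time: if `aed Y ≤ [𝒪 L]`, a
proper asymptotically Lipschitz map `f` on a closed set `A` extends to `A ∪ Y`
(`IsProperAsympLipschitzOn.exists_extension_union`). Doing this for `Y = X₁` and then for `Y = X₂`
gives an extension to `X₁ ∪ X₂ = X`.

An arbitrary extension of `f` restricted to `A ∩ Y` does not fit together with `f`, since points
of `A` and of `Y` may be close to each other while far from `A ∩ Y`. Hence `f` is first extended to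
a set `N` containing the points `x` at which the expected height of the image is large, and large
compared with the distance from `x` to `A`
(`IsProperAsympLipschitzOn.exists_extension_nhd`). To do so, the cone is mapped to `ℝ × ℝⁿ` by
`[l, t] ↦ (t, t e(l))` with `e` a bi-Lipschitz embedding of `L`; the coordinates extend over `X`
(`AsympLipschitzOn.exists_extension_real`), and a Lipschitz retraction of a neighbourhood of
`e(L)` cones off to a Lipschitz map from a conical neighbourhood back to the cone
(`OpenCone.exists_lipschitzOnWith_coneMap`).

The restriction to `N ∩ Y` of the map so obtained is extended over `Y` by hypothesis, and the
result is truncated radially at a coercive asymptotically Lipschitz function `ψ` that dominates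
the heights on `N`, so that nothing changes there, and is, off `N`, at most a multiple of the
distance to `A` up to a constant. At points of `Y \ N` and `A` the heights of the truncated map and
of `f` are then bounded by the distance between the points, up to constants, so the two maps glue
to an asymptotically Lipschitz map.
-/

/-! ### Geometry of the open cone -/

namespace OpenCone

variable {L : Type*} {E : Type*} [NormedAddCommGroup E] [NormedSpace ℝ E]

/-- The point `[x, t]` of the open cone. -/
def mk (x : L) (t : ℝ≥0) : OpenCone L := Quotient.mk (coneSetoid L) (x, t)

/-- The radial coordinate `[x, t] ↦ t`. -/
def height : OpenCone L → ℝ≥0 :=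
  Quotient.lift Prod.snd (by
    rintro p q (rfl | ⟨h, h'⟩)
    · rfl
    · exact h.trans h'.symm)

/-- The cone `[x, t] ↦ t • e x` over a map `e` into a real vector space. -/
def spread (e : L → E) : OpenCone L → E :=
  Quotient.lift (fun p => (p.2 : ℝ) • e p.1) (by
    rintro p q (rfl | ⟨h, h'⟩)
    · rfl
    · simp [h, h'])

/-- The radial truncation `[x, t] ↦ [x, min t s]`. -/
noncomputable def truncate (p : OpenCone L) (s : ℝ≥0) : OpenCone L :=
  Quotient.map (sa := coneSetoid L) (sb := coneSetoid L) (fun q => (q.1, min q.2 s)) (by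
    rintro p q (rfl | ⟨h, h'⟩)
    · exact Or.inl rfl
    · exact Or.inr ⟨by simp [h], by simp [h']⟩) p

theorem exists_eq_mk (p : OpenCone L) : ∃ x t, p = mk x t := by
  obtain ⟨⟨x, t⟩⟩ := p
  exact ⟨x, t, rfl⟩

@[simp] theorem height_mk (x : L) (t : ℝ≥0) : height (mk x t) = t := rfl

@[simp] theorem truncate_mk (x : L) (t s : ℝ≥0) : truncate (mk x t) s = mk x (min t s) := rfl

@[simp] theorem spread_mk (e : L → E)
    (x : L) (t : ℝ≥0) : spread e (mk x t) = (t : ℝ) • e x := rfl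

theorem height_truncate (p : OpenCone L) (s : ℝ≥0) : height (truncate p s) = min (height p) s := by
  obtain ⟨x, t, rfl⟩ := exists_eq_mk p
  rfl

theorem truncate_of_height_le {p : OpenCone L} {s : ℝ≥0} (h : height p ≤ s) :
    truncate p s = p := by
  obtain ⟨x, t, rfl⟩ := exists_eq_mk p
  rw [truncate_mk, min_eq_left (by simpa using h)]

/-- The cone `(t, v) ↦ [r (v / t), t]` over a map `r` into the base; it sends the points with
`t ≤ 0` to the apex. -/
noncomputable def coneMap (r : E → L)
    (p : ℝ × E) : OpenCone L :=
  mk (r (p.1⁻¹ • p.2)) p.1.toNNReal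

theorem height_coneMap (r : E → L)
    {p : ℝ × E} (hp : 0 ≤ p.1) : (height (coneMap r p) : ℝ) = p.1 := by
  rw [coneMap, height_mk, Real.coe_toNNReal _ hp]

theorem coneMap_height_spread {e : L → E}
    {r : E → L} (hr : ∀ x, r (e x) = x) (p : OpenCone L) :
    coneMap r ((height p : ℝ), spread e p) = p := by
  obtain ⟨x, t, rfl⟩ := exists_eq_mk p
  simp only [coneMap, height_mk, spread_mk, Real.toNNReal_coe]
  rcases eq_or_ne t 0 with rfl | ht
  · exact Quotient.sound (Or.inr ⟨rfl, rfl⟩)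
  · rw [smul_smul, inv_mul_cancel₀ (NNReal.coe_ne_zero.2 ht), one_smul, hr]

/-- The conical neighbourhood of opening `δ` of the cone over the range of `e`. -/
def conicalNhd (e : L → E) (δ : ℝ) :
    Set (ℝ × E) :=
  {p | 0 ≤ p.1 ∧ ∃ x, ‖p.2 - p.1 • e x‖ ≤ δ * p.1}

variable [MetricSpace L] [DiamLEOne L]

theorem dist_mk (x y : L) (t s : ℝ≥0) :
    dist (mk x t) (mk y s) = |(t : ℝ) - s| + min (t : ℝ) s * dist x y := rfl

theorem lipschitzWith_height : LipschitzWith 1 (height : OpenCone L → ℝ≥0) := by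
  refine LipschitzWith.of_dist_le_mul fun p q => ?_
  obtain ⟨x, t, rfl⟩ := exists_eq_mk p
  obtain ⟨y, s, rfl⟩ := exists_eq_mk q
  rw [dist_mk, height_mk, height_mk, NNReal.dist_eq]
  have : 0 ≤ min (t : ℝ) s * dist x y := by positivity
  simpa using this

/-- Both points lie on segments through the apex, whose lengths add up to the bound. -/
theorem dist_le_height_add_height (p q : OpenCone L) :
    dist p q ≤ height p + height q := by
  obtain ⟨x, t, rfl⟩ := exists_eq_mk p
  obtain ⟨y, s, rfl⟩ := exists_eq_mk q
  have h0 : dist (mk x t) (mk x 0) = t := by simp [dist_mk]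
  have h1 : dist (mk x 0) (mk y s) = s := by simp [dist_mk]
  have := dist_triangle (mk x t) (mk x 0) (mk y s)
  simpa [h0, h1] using this

theorem dist_truncate_le (p q : OpenCone L) (s s' : ℝ≥0) :
    dist (truncate p s) (truncate q s') ≤ dist p q + dist s s' := by
  obtain ⟨x, t, rfl⟩ := exists_eq_mk p
  obtain ⟨y, u, rfl⟩ := exists_eq_mk q
  rw [truncate_mk, truncate_mk, dist_mk, dist_mk, NNReal.dist_eq]
  push_cast
  have h1 : |min (t : ℝ) s - min (u : ℝ) s'| ≤ |(t : ℝ) - u| + |(s : ℝ) - s'| :=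
    (abs_min_sub_min_le_max _ _ _ _).trans
      (max_le_add_of_nonneg (abs_nonneg _) (abs_nonneg _))
  have h2 : min (min (t : ℝ) s) (min (u : ℝ) s') * dist x y ≤ min (t : ℝ) u * dist x y :=
    mul_le_mul_of_nonneg_right (min_le_min (min_le_left _ _) (min_le_left _ _)) dist_nonneg
  linarith

/-- Compactness of the base makes the balls around the apex compact. -/
theorem isCompact_height_le [CompactSpace L] (R : ℝ≥0) :
    IsCompact {p : OpenCone L | height p ≤ R} := by
  have hcont : Continuous fun q : L × ℝ≥0 => mk q.1 q.2 := by
    refine continuous_iff_continuousAt.2 fun q => tendsto_iff_dist_tendsto_zero.2 ?_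
    simp only [dist_mk]
    have : Continuous fun q' : L × ℝ≥0 =>
        |(q'.2 : ℝ) - q.2| + min (q'.2 : ℝ) q.2 * dist q'.1 q.1 := by fun_prop
    simpa using this.tendsto q
  convert (isCompact_univ.prod (isCompact_Icc (a := (0 : ℝ≥0)) (b := R))).image hcont using 1
  ext p
  obtain ⟨x, t, rfl⟩ := exists_eq_mk p
  constructor
  · intro h
    exact ⟨(x, t), ⟨trivial, zero_le, h⟩, rfl⟩
  · rintro ⟨⟨y, s⟩, ⟨-, -, hs⟩, h⟩
    rw [← h]
    exact hs

theorem lipschitzWith_spread {e : L → E}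
    {K B : ℝ≥0} (he : LipschitzWith K e) (hB : ∀ x, ‖e x‖ ≤ B) :
    LipschitzWith (B + K) (spread e) := by
  refine LipschitzWith.of_dist_le_mul fun p q => ?_
  obtain ⟨x, t, rfl⟩ := exists_eq_mk p
  obtain ⟨y, s, rfl⟩ := exists_eq_mk q
  have main : ∀ (x y : L) (t s : ℝ≥0), t ≤ s →
      dist (spread e (mk x t)) (spread e (mk y s)) ≤ ↑(B + K) * dist (mk x t) (mk y s) := by
    intro x y t s hts
    have hts' : (t : ℝ) ≤ s := hts
    rw [spread_mk, spread_mk, dist_eq_norm, dist_mk, min_eq_left hts']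
    have h1 : (t : ℝ) • e x - (s : ℝ) • e y = (t : ℝ) • (e x - e y) + ((t : ℝ) - s) • e y := by
      rw [smul_sub, sub_smul]; abel
    have h2 : ‖(t : ℝ) • (e x - e y)‖ ≤ t * (K * dist x y) := by
      rw [norm_smul, ← dist_eq_norm, Real.norm_of_nonneg t.coe_nonneg]
      exact mul_le_mul_of_nonneg_left (he.dist_le_mul x y) t.coe_nonneg
    have h3 : ‖((t : ℝ) - s) • e y‖ ≤ |(t : ℝ) - s| * B := by
      rw [norm_smul, Real.norm_eq_abs]
      exact mul_le_mul_of_nonneg_left (hB y) (abs_nonneg _)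
    have h4 : 0 ≤ (K : ℝ) * |(t : ℝ) - s| := by positivity
    have h5 : 0 ≤ (B : ℝ) * (t * dist x y) := by positivity
    rw [h1]
    push_cast
    linarith [norm_add_le ((t : ℝ) • (e x - e y)) (((t : ℝ) - s) • e y)]
  rcases le_total t s with h | h
  · exact main x y t s h
  · rw [dist_comm, dist_comm (mk x t)]
    exact main y x s t h

/-- A Lipschitz retraction of a neighbourhood of the base extends radially to a Lipschitz map on
a conical neighbourhood of the cone: the factor `min t t'` of the cone metric compensates for
the division by the radii. -/
theorem exists_lipschitzOnWith_coneMap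
    {e : L → E} {r : E → L} {K B : ℝ≥0} {δ : ℝ} (hB : ∀ x, ‖e x‖ ≤ B)
    (hr : LipschitzOnWith K r {v | ∃ x, ‖v - e x‖ ≤ δ}) :
    ∃ C, LipschitzOnWith C (coneMap r) (conicalNhd e δ) := by
  refine ⟨1 + K * (1 + (B + δ.toNNReal)), LipschitzOnWith.of_dist_le_mul ?_⟩
  have scaled : ∀ p ∈ conicalNhd e δ, 0 < p.1 → ∃ x, ‖p.1⁻¹ • p.2 - e x‖ ≤ δ := by
    rintro p ⟨-, x, hx⟩ h
    refine ⟨x, ?_⟩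
    have : p.1⁻¹ • p.2 - e x = p.1⁻¹ • (p.2 - p.1 • e x) := by
      rw [smul_sub, smul_smul, inv_mul_cancel₀ h.ne', one_smul]
    rw [this, norm_smul, norm_inv, Real.norm_of_nonneg h.le, inv_mul_le_iff₀ h]
    linarith
  have main : ∀ p ∈ conicalNhd e δ, ∀ q ∈ conicalNhd e δ, p.1 ≤ q.1 →
      dist (coneMap r p) (coneMap r q) ≤ ↑(1 + K * (1 + (B + δ.toNNReal))) * dist p q := by
    intro p hp q hq hpq
    have hp0 := hp.1
    have hd1 : |p.1 - q.1| ≤ dist p q := (Real.dist_eq _ _).symm.le.trans (le_max_left _ _)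
    have hd2 : ‖p.2 - q.2‖ ≤ dist p q := (dist_eq_norm _ _).symm.le.trans (le_max_right _ _)
    rw [coneMap, coneMap, dist_mk, Real.coe_toNNReal _ hp0, Real.coe_toNNReal _ hq.1,
      min_eq_left hpq]
    rcases hp0.eq_or_lt with h0 | h0
    · rw [← h0, zero_mul, add_zero, h0]
      refine hd1.trans (le_mul_of_one_le_left dist_nonneg ?_)
      push_cast
      have : (0 : ℝ) ≤ K * (1 + (B + (δ.toNNReal : ℝ))) := by positivity
      linarith
    have hq0 : 0 < q.1 := h0.trans_le hpq
    obtain ⟨y, hy⟩ := scaled q hq hq0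
    have hδ : 0 ≤ δ := (norm_nonneg _).trans hy
    have hnorm : ‖q.1⁻¹ • q.2‖ ≤ B + δ := by
      have := norm_add_le (q.1⁻¹ • q.2 - e y) (e y)
      rw [sub_add_cancel] at this
      linarith [hB y]
    have h1 := hr.dist_le_mul _ (scaled p hp h0) _ ⟨y, hy⟩
    have h2 : p.1 * dist (p.1⁻¹ • p.2) (q.1⁻¹ • q.2)
        ≤ ‖p.2 - q.2‖ + |p.1 - q.1| * (B + δ) := by
      have e1 : p.1 • (p.1⁻¹ • p.2 - q.1⁻¹ • q.2)
          = (p.2 - q.2) - (p.1 - q.1) • (q.1⁻¹ • q.2) := by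
        rw [smul_sub, smul_smul, mul_inv_cancel₀ h0.ne', one_smul, sub_smul, smul_smul q.1,
          mul_inv_cancel₀ hq0.ne', one_smul]
        abel
      calc p.1 * dist (p.1⁻¹ • p.2) (q.1⁻¹ • q.2)
          = ‖p.1 • (p.1⁻¹ • p.2 - q.1⁻¹ • q.2)‖ := by
            rw [norm_smul, dist_eq_norm, Real.norm_of_nonneg hp0]
        _ ≤ ‖p.2 - q.2‖ + ‖(p.1 - q.1) • (q.1⁻¹ • q.2)‖ := by
            rw [e1]; exact norm_sub_le _ _
        _ ≤ _ := by
            rw [norm_smul, Real.norm_eq_abs]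
            gcongr
    have h3 : p.1 * dist (r (p.1⁻¹ • p.2)) (r (q.1⁻¹ • q.2))
        ≤ K * (dist p q + dist p q * (B + δ)) :=
      calc _ ≤ p.1 * (K * dist (p.1⁻¹ • p.2) (q.1⁻¹ • q.2)) := by gcongr
        _ = K * (p.1 * dist (p.1⁻¹ • p.2) (q.1⁻¹ • q.2)) := by ring
        _ ≤ _ := by
            refine mul_le_mul_of_nonneg_left (h2.trans ?_) K.coe_nonneg
            gcongr
    push_cast
    rw [Real.coe_toNNReal _ hδ]
    linarith
  intro p hp q hq
  rcases le_total p.1 q.1 with h | h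
  · exact main p hp q hq h
  · rw [dist_comm, dist_comm p]
    exact main q hq p hp h

end OpenCone

/-! ### Asymptotically Lipschitz maps on subsets -/

/-- `f` is asymptotically Lipschitz on `S`, with a single constant serving as the slope and as
the additive error. -/
def AsympLipschitzOn {X Y : Type*} [PseudoMetricSpace X] [PseudoMetricSpace Y] (f : X → Y)
    (S : Set X) : Prop :=
  ∃ C : ℝ, 0 < C ∧ ∀ x ∈ S, ∀ y ∈ S, dist (f x) (f y) ≤ C * dist x y + C

section AsympLipschitzOn

variable {X Y Z : Type*} [PseudoMetricSpace X] [PseudoMetricSpace Y] [PseudoMetricSpace Z]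

theorem LipschitzOnWith.comp_asympLipschitzOn {K : ℝ≥0} {g : Y → Z} {T : Set Y}
    (hg : LipschitzOnWith K g T) {f : X → Y} {S : Set X} (hf : AsympLipschitzOn f S)
    (h : Set.MapsTo f S T) : AsympLipschitzOn (g ∘ f) S := by
  obtain ⟨C, hC, hf⟩ := hf
  refine ⟨(K + 1) * C, by positivity, fun x hx y hy => ?_⟩
  have h1 := hg.dist_le_mul _ (h hx) _ (h hy)
  have h2 := mul_le_mul_of_nonneg_left (hf x hx y hy) K.coe_nonneg
  have h3 : 0 ≤ C * dist x y + C := by positivity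
  simp only [Function.comp]
  linarith

theorem LipschitzWith.comp_asympLipschitzOn {K : ℝ≥0} {g : Y → Z}
    (hg : LipschitzWith K g) {f : X → Y} {S : Set X} (hf : AsympLipschitzOn f S) :
    AsympLipschitzOn (g ∘ f) S :=
  (hg.lipschitzOnWith (s := Set.univ)).comp_asympLipschitzOn hf (Set.mapsTo_univ _ _)

theorem AsympLipschitzOn.prodMk {f : X → Y} {g : X → Z} {S : Set X} (hf : AsympLipschitzOn f S)
    (hg : AsympLipschitzOn g S) : AsympLipschitzOn (fun x => (f x, g x)) S := by
  obtain ⟨C, hC, hf⟩ := hf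
  obtain ⟨D, hD, hg⟩ := hg
  refine ⟨C + D, by positivity, fun x hx y hy => ?_⟩
  have := dist_nonneg (x := x) (y := y)
  exact max_le (by nlinarith [hf x hx y hy]) (by nlinarith [hg x hx y hy])

theorem AsympLipschitzOn.mono {f : X → Y} {S T : Set X} (hf : AsympLipschitzOn f T) (h : S ⊆ T) :
    AsympLipschitzOn f S := by
  obtain ⟨C, hC, hf⟩ := hf
  exact ⟨C, hC, fun x hx y hy => hf x (h hx) y (h hy)⟩

/-- The inf-convolution with a multiple of the distance is Lipschitz and differs from the given
function by a bounded amount; the difference is extended by Tietze's theorem. -/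
theorem AsympLipschitzOn.exists_extension_real {A : Set X} (hA : IsClosed A) (hne : A.Nonempty)
    {f : X → ℝ} (hc : ContinuousOn f A) (hf : AsympLipschitzOn f A) :
    ∃ g : X → ℝ, Continuous g ∧ AsympLipschitzOn g Set.univ ∧ Set.EqOn g f A := by
  obtain ⟨C, hC, hf⟩ := hf
  obtain ⟨a₀, ha₀⟩ := hne
  have : Nonempty A := ⟨⟨a₀, ha₀⟩⟩
  set h : X → ℝ := fun x => ⨅ a : A, (f a + C * dist x a)
  have hbdd : ∀ x : X, BddBelow (Set.range fun a : A => f a + C * dist x a) := by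
    intro x
    refine ⟨f a₀ - C - C * dist x a₀, ?_⟩
    rintro _ ⟨a, rfl⟩
    have h1 := (abs_le.1 (hf a₀ ha₀ a a.2)).2
    have h2 : C * dist a₀ a ≤ C * (dist x a₀ + dist x a) := by
      gcongr; exact dist_triangle_left _ _ _
    simp only
    linarith
  have hlip : LipschitzWith ⟨C, hC.le⟩ h := by
    refine LipschitzWith.of_le_add_mul _ fun x y => ?_
    rw [← sub_le_iff_le_add]
    refine le_ciInf fun a => ?_
    have h1 := ciInf_le (hbdd x) a
    have h2 : C * dist x a ≤ C * (dist x y + dist y a) := by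
      gcongr; exact dist_triangle _ _ _
    change h x - C * dist x y ≤ _
    change h x ≤ _ at h1
    linarith
  have hdiff : ∀ a ∈ A, f a - h a ∈ Set.Icc 0 C := by
    intro a ha
    constructor
    · have h1 := ciInf_le (hbdd a) ⟨a, ha⟩
      simp only [dist_self, mul_zero, add_zero] at h1
      change h a ≤ f a at h1
      linarith
    · have : f a - C ≤ h a := le_ciInf fun b => by
        have h1 := (abs_le.1 (hf a ha b b.2)).2
        linarith
      linarith
  have hcont : Continuous fun a : A => f a - h a :=
    (continuousOn_iff_continuous_domRestrict.1 hc).sub (hlip.continuous.comp continuous_subtype_val)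
  obtain ⟨w, hw, hwA⟩ := ContinuousMap.exists_restrict_eq_forall_mem_of_closed
    ⟨fun a : A => f a - h a, hcont⟩ (t := Set.Icc 0 C) (fun a => hdiff a a.2)
    ⟨0, le_rfl, hC.le⟩ hA
  refine ⟨fun x => h x + w x, hlip.continuous.add w.continuous, ⟨C, hC, fun x _ y _ => ?_⟩,
    fun a ha => ?_⟩
  · have h1 := hlip.dist_le_mul x y
    have h2 := Real.dist_le_of_mem_Icc (hw x) (hw y)
    have h3 := dist_add_add_le (h x) (w x) (h y) (w y)
    change _ ≤ C * dist x y at h1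
    linarith
  · have : w a = f a - h a := congrArg (fun k : C(A, ℝ) => k ⟨a, ha⟩) hwA
    simp [this]

theorem AsympLipschitzOn.exists_extension_euclidean {n : ℕ} {A : Set X} (hA : IsClosed A)
    (hne : A.Nonempty) {f : X → EuclideanSpace ℝ (Fin n)} (hc : ContinuousOn f A)
    (hf : AsympLipschitzOn f A) :
    ∃ g : X → EuclideanSpace ℝ (Fin n),
      Continuous g ∧ AsympLipschitzOn g Set.univ ∧ Set.EqOn g f A := by
  have hcoord : ∀ i, ∃ g : X → ℝ, Continuous g ∧ AsympLipschitzOn g Set.univ ∧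
      Set.EqOn g (fun x => f x i) A := by
    intro i
    refine exists_extension_real hA hne
      ((EuclideanSpace.proj (𝕜 := ℝ) i).continuous.comp_continuousOn hc) ?_
    exact (EuclideanSpace.proj (𝕜 := ℝ) i : EuclideanSpace ℝ (Fin n) →L[ℝ] ℝ).lipschitz
      |>.comp_asympLipschitzOn hf
  choose g hgc hg hgA using hcoord
  choose C hC hg using hg
  have hpi : AsympLipschitzOn (fun x i => g i x) Set.univ := by
    refine ⟨∑ i, C i + 1, ?_, fun x _ y _ => ?_⟩
    · linarith [Finset.sum_nonneg fun i (_ : i ∈ Finset.univ) => (hC i).le]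
    · have hS : ∀ i, C i ≤ ∑ i, C i + 1 := fun i => by
        linarith [Finset.single_le_sum (fun i _ => (hC i).le) (Finset.mem_univ i)]
      have h0 : ∀ i, dist (g i x) (g i y) ≤ (∑ i, C i + 1) * dist x y + (∑ i, C i + 1) :=
        fun i => (hg i x trivial y trivial).trans
          (add_le_add (mul_le_mul_of_nonneg_right (hS i) dist_nonneg) (hS i))
      refine (dist_pi_le_iff ?_).2 h0
      have := Finset.sum_nonneg fun i (_ : i ∈ Finset.univ) => (hC i).le
      positivity
  refine ⟨fun x => WithLp.toLp 2 fun i => g i x, ?_, ?_, fun a ha => ?_⟩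
  · exact (PiLp.continuous_toLp 2 _).comp (continuous_pi hgc)
  · exact (PiLp.lipschitzWith_toLp 2 fun _ : Fin n => ℝ).comp_asympLipschitzOn hpi
  · ext i
    exact hgA i ha

end AsympLipschitzOn

/-! ### Proper asymptotically Lipschitz maps into the cone -/

/-- `f` restricts to a proper asymptotically Lipschitz map from `S` to the open cone. Properness
is encoded as boundedness of the sets on which the radial coordinate is bounded; for closed `S`
in a proper space and compact base this is the topological notion, see
`isProperAsympLipschitzOn_univ_iff`. -/
structure IsProperAsympLipschitzOn {X L : Type*} [MetricSpace X] [MetricSpace L] [DiamLEOne L]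
    (f : X → OpenCone L) (S : Set X) : Prop where
  continuousOn : ContinuousOn f S
  asympLipschitzOn : AsympLipschitzOn f S
  isBounded : ∀ R : ℝ≥0, Bornology.IsBounded {x | x ∈ S ∧ OpenCone.height (f x) ≤ R}

section Proper

variable {X L : Type*} [MetricSpace X] [MetricSpace L] [DiamLEOne L]

theorem isProperAsympLipschitzOn_univ_iff [ProperSpace X] [CompactSpace L]
    (f : X → OpenCone L) :
    IsProperAsympLipschitzOn f Set.univ ↔ IsProperMap f ∧ AsympLipschitz f := by
  constructor
  · rintro ⟨hc, ⟨C, hC, hf⟩, hb⟩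
    have hc := continuousOn_univ.1 hc
    refine ⟨isProperMap_iff_isCompact_preimage.2 ⟨hc, fun K hK => ?_⟩,
      C, C, hC, hC, fun x y => hf x trivial y trivial⟩
    obtain ⟨R, hR⟩ := (hK.image OpenCone.lipschitzWith_height.continuous).bddAbove
    refine Metric.isCompact_of_isClosed_isBounded (hK.isClosed.preimage hc) ((hb R).subset ?_)
    exact fun x hx => ⟨trivial, hR ⟨f x, hx, rfl⟩⟩
  · rintro ⟨hp, c, ε, hc, hε, hf⟩
    refine ⟨hp.continuous.continuousOn, ⟨c + ε, by positivity, fun x _ y _ => ?_⟩, fun R => ?_⟩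
    · have := dist_nonneg (x := x) (y := y)
      nlinarith [hf x y]
    · simpa using (hp.isCompact_preimage (OpenCone.isCompact_height_le R)).isBounded

theorem Isometry.isProperAsympLipschitzOn_comp_iff {Z : Type*} [MetricSpace Z] {i : Z → X}
    (hi : Isometry i) (f : X → OpenCone L) :
    IsProperAsympLipschitzOn (f ∘ i) Set.univ ↔ IsProperAsympLipschitzOn f (Set.range i) := by
  have hcont : ContinuousOn f (Set.range i) ↔ ContinuousOn (f ∘ i) Set.univ := by
    rw [← Set.image_univ, hi.isUniformInducing.isInducing.continuousOn_image_iff]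
  constructor
  · rintro ⟨hc, ⟨C, hC, hf⟩, hb⟩
    refine ⟨hcont.2 hc, ⟨C, hC, ?_⟩, fun R => ?_⟩
    · rintro _ ⟨x, rfl⟩ _ ⟨y, rfl⟩
      rw [hi.dist_eq]
      exact hf x trivial y trivial
    · refine (hi.lipschitz.isBounded_image (hb R)).subset ?_
      rintro _ ⟨⟨x, rfl⟩, hx⟩
      exact ⟨x, ⟨trivial, hx⟩, rfl⟩
  · rintro ⟨hc, ⟨C, hC, hf⟩, hb⟩
    refine ⟨hcont.1 hc, ⟨C, hC, fun x _ y _ => ?_⟩, fun R => ?_⟩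
    · rw [← hi.dist_eq]
      exact hf _ ⟨x, rfl⟩ _ ⟨y, rfl⟩
    · exact (hi.antilipschitz.isBounded_preimage (hb R)).subset fun x hx => ⟨⟨x, rfl⟩, hx.2⟩

/-- The extension property of a subspace `Y`, for maps defined on subsets of the ambient
space. -/
theorem AedLE.exists_extension [ProperSpace X] [CompactSpace L] {Y : Set X} (hY : IsClosed Y)
    (h : AedLE Y L) {N : Set X} (hN : IsClosed N) {f : X → OpenCone L}
    (hf : IsProperAsympLipschitzOn f N) :
    ∃ g : X → OpenCone L, IsProperAsympLipschitzOn g Y ∧ Set.EqOn g f (N ∩ Y) := by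
  classical
  have : ProperSpace Y := .of_isClosed hY
  have hN' : IsClosed ((↑) ⁻¹' N : Set Y) := hN.preimage continuous_subtype_val
  have : ProperSpace ((↑) ⁻¹' N : Set Y) := .of_isClosed hN'
  set i : ((↑) ⁻¹' N : Set Y) → X := fun a => a.1.1
  have hi : Isometry i := isometry_subtype_coe.comp isometry_subtype_coe
  have hfi : IsProperAsympLipschitzOn (f ∘ i) Set.univ := by
    refine (hi.isProperAsympLipschitzOn_comp_iff f).2 ?_
    have hsub : Set.range i ⊆ N := by
      rintro _ ⟨a, rfl⟩
      exact a.2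
    exact ⟨hf.continuousOn.mono hsub, hf.asympLipschitzOn.mono hsub,
      fun R => (hf.isBounded R).subset fun x hx => ⟨hsub hx.1, hx.2⟩⟩
  obtain ⟨hp, hl⟩ := (isProperAsympLipschitzOn_univ_iff _).1 hfi
  obtain ⟨g, hgp, hgl, hg⟩ := h _ hN' _ hp hl
  have hval : (fun x => if hx : x ∈ Y then g ⟨x, hx⟩ else f x) ∘ ((↑) : Y → X) = g := by
    ext y
    simp
  refine ⟨fun x => if hx : x ∈ Y then g ⟨x, hx⟩ else f x, ?_, ?_⟩
  · have := (isometry_subtype_coe (s := Y)).isProperAsympLipschitzOn_comp_iff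
      (fun x => if hx : x ∈ Y then g ⟨x, hx⟩ else f x)
    rw [Subtype.range_coe, hval] at this
    exact this.1 ((isProperAsympLipschitzOn_univ_iff g).2 ⟨hgp, hgl⟩)
  · rintro x ⟨hxN, hxY⟩
    simp only [hxY, dif_pos]
    exact hg ⟨⟨x, hxY⟩, hxN⟩

/-- Truncation at the values of a coercive asymptotically Lipschitz function preserves proper
asymptotically Lipschitz maps. -/
theorem IsProperAsympLipschitzOn.truncate {S : Set X} {f : X → OpenCone L}
    (hf : IsProperAsympLipschitzOn f S) {ψ : X → ℝ≥0} (hψc : Continuous ψ)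
    (hψ : AsympLipschitzOn ψ Set.univ) (hψb : ∀ R : ℝ≥0, Bornology.IsBounded {x | ψ x ≤ R}) :
    IsProperAsympLipschitzOn (fun x => OpenCone.truncate (f x) (ψ x)) S := by
  refine ⟨?_, ?_, fun R => ?_⟩
  · intro x hx
    have h1 := tendsto_iff_dist_tendsto_zero.1 (hf.continuousOn x hx)
    have h2 := tendsto_iff_dist_tendsto_zero.1 (hψc.continuousWithinAt (s := S) (x := x))
    have h3 := h1.add h2
    rw [add_zero] at h3
    exact tendsto_iff_dist_tendsto_zero.2 (squeeze_zero (fun _ => dist_nonneg)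
      (fun _ => OpenCone.dist_truncate_le _ _ _ _) h3)
  · obtain ⟨C, hC, hf⟩ := hf.asympLipschitzOn
    obtain ⟨D, hD, hψ⟩ := hψ
    refine ⟨C + D, by positivity, fun x hx y hy => ?_⟩
    linarith [OpenCone.dist_truncate_le (f x) (f y) (ψ x) (ψ y), hf x hx y hy,
      hψ x trivial y trivial]
  · refine ((hf.isBounded R).union (hψb R)).subset ?_
    rintro x ⟨hx, hxR⟩
    rw [OpenCone.height_truncate] at hxR
    rcases min_le_iff.1 hxR with h | h
    · exact Or.inl ⟨hx, h⟩
    · exact Or.inr h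

end Proper

/-! ### Extension to a neighbourhood growing with the radial coordinate -/

section Neighbourhood

variable {X L : Type*} [MetricSpace X] [MetricSpace L]

/-- Some uniform neighbourhood of a euclidean copy of a compact ALNER admits a Lipschitz
retraction onto it. -/
theorem IsCompactALNER.exists_lipschitz_retraction (hL : IsCompactALNER L) [Nonempty L] :
    ∃ (n : ℕ) (e : L → EuclideanSpace ℝ (Fin n)) (r : EuclideanSpace ℝ (Fin n) → L)
      (K B K' : ℝ≥0) (δ : ℝ), 0 < δ ∧ LipschitzWith K e ∧ (∀ x, ‖e x‖ ≤ B) ∧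
        (∀ x, r (e x) = x) ∧ LipschitzOnWith K' r {v | ∃ x, ‖v - e x‖ ≤ δ} := by
  classical
  have := hL.compact
  obtain ⟨n, e, ⟨K, hK⟩, K₂, hK₂⟩ := hL.embeds
  have hcpt : IsCompact (Set.range e) := isCompact_range hK.continuous
  obtain ⟨U, hUo, hAU, g, ⟨K', hg⟩, hgA⟩ := hL.extends_nhds n (Set.range e) hcpt.isClosed
    (fun a => a.2.choose) ⟨K₂, LipschitzWith.of_dist_le_mul fun a b => by
      have := hK₂.le_mul_dist a.2.choose b.2.choose
      rwa [a.2.choose_spec, b.2.choose_spec] at this⟩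
  obtain ⟨δ, hδ, hδU⟩ := hcpt.exists_cthickening_subset_open hUo hAU
  obtain ⟨B, hB⟩ := hcpt.isBounded.exists_norm_le
  refine ⟨n, e, fun v => if h : v ∈ U then g ⟨v, h⟩ else Classical.arbitrary L, K, B.toNNReal, K',
    δ, hδ, hK, fun x => (hB _ ⟨x, rfl⟩).trans (Real.le_coe_toNNReal B), fun x => ?_, ?_⟩
  · have hx : e x ∈ U := hAU ⟨x, rfl⟩
    simp only [hx, dif_pos]
    refine (hgA ⟨e x, x, rfl⟩).trans (hK₂.injective ?_)
    exact Exists.choose_spec (p := fun y => e y = e x) ⟨x, rfl⟩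
  · have hsub : {v | ∃ x, ‖v - e x‖ ≤ δ} ⊆ U := by
      rintro v ⟨x, hx⟩
      refine hδU (Metric.mem_cthickening_of_dist_le v (e x) δ _ ⟨x, rfl⟩ ?_)
      rwa [dist_eq_norm]
    refine LipschitzOnWith.of_dist_le_mul fun v hv w hw => ?_
    simp only [hsub hv, hsub hw, dif_pos]
    exact hg.dist_le_mul ⟨v, hsub hv⟩ ⟨w, hsub hw⟩

variable [DiamLEOne L]

/-- A proper asymptotically Lipschitz map `f` on `A` extends to a set `N` containing all points
whose expected height is large, and large compared with the distance to `A`. The coercive function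
`ψ` dominates the height of the extension, and off `N` it is controlled by the distance to `A`. -/
theorem IsProperAsympLipschitzOn.exists_extension_nhd [ProperSpace X] (hL : IsCompactALNER L)
    {A : Set X} (hA : IsClosed A) (hne : A.Nonempty) {f : X → OpenCone L}
    (hf : IsProperAsympLipschitzOn f A) :
    ∃ (N : Set X) (F : X → OpenCone L) (ψ : X → ℝ≥0), IsClosed N ∧ A ⊆ N ∧
      IsProperAsympLipschitzOn F N ∧ Set.EqOn F f A ∧ Continuous ψ ∧
      AsympLipschitzOn ψ Set.univ ∧ (∀ R : ℝ≥0, Bornology.IsBounded {x | ψ x ≤ R}) ∧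
      (∀ x ∈ N, OpenCone.height (F x) ≤ ψ x) ∧
      ∃ C : ℝ, 0 < C ∧ ∀ x ∉ N, (ψ x : ℝ) ≤ C * Metric.infDist x A + C := by
  have hLne : Nonempty L := by
    obtain ⟨a, -⟩ := hne
    obtain ⟨l, -, -⟩ := OpenCone.exists_eq_mk (f a)
    exact ⟨l⟩
  obtain ⟨n, e, r, K, B, K', δ, hδ, he, hB, hre, hr⟩ := hL.exists_lipschitz_retraction
  obtain ⟨Kρ, hρ⟩ := OpenCone.exists_lipschitzOnWith_coneMap hB hr
  have hspread := OpenCone.lipschitzWith_spread he hB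
  have hheight : LipschitzWith 1 fun p : OpenCone L => (OpenCone.height p : ℝ) :=
    LipschitzWith.of_dist_le_mul fun p q => OpenCone.lipschitzWith_height.dist_le_mul p q
  -- Extend the two euclidean coordinates of `f`, keeping the radial one nonnegative.
  obtain ⟨τ₀, hτ₀c, hτ₀, hτ₀A⟩ := AsympLipschitzOn.exists_extension_real hA hne
    (hheight.continuous.comp_continuousOn hf.continuousOn)
    (hheight.comp_asympLipschitzOn hf.asympLipschitzOn)
  obtain ⟨v, hvc, hv, hvA⟩ := AsympLipschitzOn.exists_extension_euclidean hA hne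
    (hspread.continuous.comp_continuousOn hf.continuousOn)
    (hspread.comp_asympLipschitzOn hf.asympLipschitzOn)
  set τ : X → ℝ≥0 := fun x => (τ₀ x).toNNReal
  have hτc : Continuous τ := continuous_real_toNNReal.comp hτ₀c
  have hτ : AsympLipschitzOn τ Set.univ := by
    refine LipschitzWith.comp_asympLipschitzOn (K := 1) (g := Real.toNNReal) ?_ hτ₀
    exact lipschitzWith_posPart
  have hτA : ∀ a ∈ A, τ a = OpenCone.height (f a) := fun a ha => by
    simp only [τ, hτ₀A ha, Function.comp, Real.toNNReal_coe]
  have hvA : ∀ a ∈ A, v a = OpenCone.spread e (f a) := fun a ha => hvA ha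
  have hcone : ∀ a ∈ A, ∃ x, v a = (τ a : ℝ) • e x := fun a ha => by
    rw [hvA a ha, hτA a ha]
    obtain ⟨x, t, h⟩ := OpenCone.exists_eq_mk (f a)
    exact ⟨x, by rw [h]; rfl⟩
  have hq : AsympLipschitzOn (fun x => ((τ x : ℝ), v x)) Set.univ :=
    AsympLipschitzOn.prodMk (f := fun x => (τ x : ℝ)) hτ hv
  obtain ⟨Cτ, hCτ, hτ'⟩ := hτ
  obtain ⟨Cv, hCv, hv'⟩ := hv
  -- With these constants the points of `N` have coordinates in the conical neighbourhood: `η`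
  -- makes the linear part of the error at most `δ / 2 * τ`, and `T` the additive part.
  set D : ℝ := Cv + Cτ * B with hD
  have hD0 : 0 < D := by positivity
  set η : ℝ := δ / (2 * D) with hη
  set T : ℝ := 2 * D / δ with hT
  have hη0 : 0 < η := by positivity
  have hT0 : 0 < T := by positivity
  set N : Set X := A ∪ {x | T ≤ τ x ∧ Metric.infDist x A ≤ η * τ x}
  have hNclosed : IsClosed N := by
    have hτc' : Continuous fun x => (τ x : ℝ) := NNReal.continuous_coe.comp hτc
    exact hA.union ((isClosed_le continuous_const hτc').inter
      (isClosed_le (Metric.continuous_infDist_pt A) (continuous_const.mul hτc')))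
  have hnear : ∀ x, ∃ a ∈ A, Metric.infDist x A = dist x a := hA.exists_infDist_eq_dist hne
  have hmaps : Set.MapsTo (fun x => ((τ x : ℝ), v x)) N (OpenCone.conicalNhd e δ) := by
    rintro x (hx | ⟨hxT, hxd⟩)
    · obtain ⟨y, hy⟩ := hcone x hx
      refine ⟨(τ x).coe_nonneg, y, ?_⟩
      simp only [hy, sub_self, norm_zero]
      positivity
    · obtain ⟨a, ha, hxa⟩ := hnear x
      obtain ⟨y, hy⟩ := hcone a ha
      refine ⟨(τ x).coe_nonneg, y, ?_⟩
      simp only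
      have h1 : v x - (τ x : ℝ) • e y = (v x - v a) - ((τ x : ℝ) - τ a) • e y := by
        rw [hy, sub_smul]; abel
      have h2 : ‖v x - v a‖ ≤ Cv * dist x a + Cv := by
        rw [← dist_eq_norm]; exact hv' x trivial a trivial
      have h3 : ‖((τ x : ℝ) - τ a) • e y‖ ≤ (Cτ * dist x a + Cτ) * B := by
        rw [norm_smul, Real.norm_eq_abs, ← NNReal.dist_eq]
        exact mul_le_mul (hτ' x trivial a trivial) (hB y) (norm_nonneg _) (by positivity)
      have h4 : D * dist x a ≤ D * (η * τ x) := by rw [← hxa]; gcongr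
      have h5 : D * η = δ / 2 := by rw [hη]; field_simp
      have h6 : D = δ / 2 * T := by rw [hT]; field_simp
      have h7 : δ / 2 * T ≤ δ / 2 * τ x := by gcongr
      rw [h1]
      calc _ ≤ ‖v x - v a‖ + ‖((τ x : ℝ) - τ a) • e y‖ := norm_sub_le _ _
        _ ≤ D * dist x a + D := by rw [hD]; linarith
        _ ≤ δ * τ x := by
          rw [← mul_assoc, h5] at h4
          linarith
  set M : ℝ≥0 := ⟨Cτ + 1, by positivity⟩
  set ψ : X → ℝ≥0 := fun x => τ x + M * Metric.infNndist x A
  have hψcoe : ∀ x, (ψ x : ℝ) = τ x + (Cτ + 1) * Metric.infDist x A := fun x => rfl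
  have hψc : Continuous ψ := hτc.add (continuous_const.mul (Metric.continuous_infNndist_pt A))
  -- The slope of `M` beats the rate at which `τ` can decrease away from `A`.
  have hψb : ∀ R : ℝ≥0, Bornology.IsBounded {x | ψ x ≤ R} := by
    intro R
    refine (hf.isBounded (R + Cτ.toNNReal)).cthickening (δ := R + Cτ) |>.subset ?_
    intro x hx
    obtain ⟨a, ha, hxa⟩ := hnear x
    have h1 : (ψ x : ℝ) ≤ R := hx
    rw [hψcoe, hxa] at h1
    have h2 := hτ' a trivial x trivial
    rw [NNReal.dist_eq, dist_comm] at h2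
    have h3 := le_abs_self ((τ a : ℝ) - τ x)
    have h4 := (τ a).coe_nonneg
    have h5 := dist_nonneg (x := x) (y := a)
    refine Metric.mem_cthickening_of_dist_le x a _ _ ⟨ha, ?_⟩ (by linarith)
    rw [← hτA a ha, ← NNReal.coe_le_coe, NNReal.coe_add, Real.coe_toNNReal _ hCτ.le]
    linarith
  have hheightF : ∀ x, OpenCone.height (OpenCone.coneMap r ((τ x : ℝ), v x)) = τ x := fun x =>
    NNReal.coe_injective (OpenCone.height_coneMap r (τ x).coe_nonneg)
  have hψτ : ∀ x, τ x ≤ ψ x := fun x => le_self_add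
  refine ⟨N, OpenCone.coneMap r ∘ fun x => ((τ x : ℝ), v x), ψ, hNclosed,
    Set.subset_union_left, ⟨?_, ?_, fun R => ?_⟩, fun a ha => ?_, hψc, ?_, hψb,
    fun x _ => (hheightF x).trans_le (hψτ x), ?_⟩
  · exact hρ.continuousOn.comp (by fun_prop) hmaps
  · exact hρ.comp_asympLipschitzOn (hq.mono (Set.subset_univ _)) hmaps
  · refine (hψb (R + M * (η.toNNReal * R))).subset ?_
    rintro x ⟨hx, hxR⟩
    have hxR' : τ x ≤ R := (hheightF x).symm.trans_le hxR
    have hinf : Metric.infNndist x A ≤ η.toNNReal * R := by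
      rcases hx with hx | ⟨-, hx⟩
      · rw [← NNReal.coe_le_coe, Metric.coe_infNndist, Metric.infDist_zero_of_mem hx]
        positivity
      · rw [← NNReal.coe_le_coe, Metric.coe_infNndist, NNReal.coe_mul,
          Real.coe_toNNReal _ hη0.le]
        refine hx.trans ?_
        gcongr
    exact add_le_add hxR' (mul_le_mul_right hinf M)
  · simp only [Function.comp, hτA a ha, hvA a ha]
    exact OpenCone.coneMap_height_spread hre _
  · refine ⟨Cτ + (Cτ + 1), by positivity, fun x _ y _ => ?_⟩
    have h1 := hτ' x trivial y trivial
    have h2 := (Metric.lipschitz_infDist_pt A).dist_le_mul x y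
    rw [NNReal.coe_one, one_mul, Real.dist_eq] at h2
    rw [NNReal.dist_eq] at h1 ⊢
    rw [hψcoe, hψcoe]
    have h3 : (τ x : ℝ) + (Cτ + 1) * Metric.infDist x A - (τ y + (Cτ + 1) * Metric.infDist y A)
      = ((τ x : ℝ) - τ y) + (Cτ + 1) * (Metric.infDist x A - Metric.infDist y A) := by ring
    have h4 : |(Cτ + 1) * (Metric.infDist x A - Metric.infDist y A)| ≤ (Cτ + 1) * dist x y := by
      rw [abs_mul, abs_of_pos (by positivity : 0 < Cτ + 1)]
      gcongr
    rw [h3]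
    linarith [abs_add_le ((τ x : ℝ) - τ y)
      ((Cτ + 1) * (Metric.infDist x A - Metric.infDist y A))]
  · refine ⟨T + η⁻¹ + (Cτ + 1), by positivity, fun x hx => ?_⟩
    have hd := Metric.infDist_nonneg (x := x) (s := A)
    rw [hψcoe]
    have h1 : (τ x : ℝ) ≤ T + η⁻¹ * Metric.infDist x A := by
      by_contra! hlt
      refine hx (Or.inr ⟨?_, ?_⟩)
      · have : 0 ≤ η⁻¹ * Metric.infDist x A := by positivity
        linarith
      · rw [← inv_mul_le_iff₀ hη0]
        linarith
    have h2 : 0 ≤ T * Metric.infDist x A := by positivity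
    have h3 : 0 < η⁻¹ := by positivity
    linarith

end Neighbourhood

/-! ### Adjoining one closed subspace -/

section Adjoin

variable {X L : Type*} [MetricSpace X] [ProperSpace X] [MetricSpace L] [DiamLEOne L]

/-- If `aed Y ≤ [𝒪 L]`, every proper asymptotically Lipschitz map on `A` extends to `A ∪ Y`.
The extension over `Y` is first prescribed on the neighbourhood `N` of `A` and then truncated at
`ψ`. A pair of points `a ∈ A`, `y ∈ Y \ N` then causes no trouble: both values have height at most
a multiple of the distance between `a` and `y`, up to a constant. -/
theorem IsProperAsympLipschitzOn.exists_extension_union (hL : IsCompactALNER L) {A Y : Set X}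
    (hA : IsClosed A) (hne : A.Nonempty) (hY : IsClosed Y) (h : AedLE Y L) {f : X → OpenCone L}
    (hf : IsProperAsympLipschitzOn f A) :
    ∃ g : X → OpenCone L, IsProperAsympLipschitzOn g (A ∪ Y) ∧ Set.EqOn g f A := by
  classical
  have := hL.compact
  obtain ⟨N, F, ψ, hN, hAN, hF, hFf, hψc, hψ, hψb, hFψ, C, hC, hψN⟩ :=
    hf.exists_extension_nhd hL hA hne
  obtain ⟨G₀, hG₀, hG₀F⟩ := h.exists_extension hY hN hF
  set G : X → OpenCone L := fun x => OpenCone.truncate (G₀ x) (ψ x) with hG_def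
  have hG : IsProperAsympLipschitzOn G Y := hG₀.truncate hψc hψ hψb
  have hGF : ∀ y ∈ N ∩ Y, G y = F y := fun y hy => by
    simp only [hG_def, hG₀F hy]
    exact OpenCone.truncate_of_height_le (hFψ y hy.1)
  have hGψ : ∀ y, (OpenCone.height (G y) : ℝ) ≤ ψ y := fun y => by
    rw [hG_def, OpenCone.height_truncate]
    exact_mod_cast min_le_right _ _
  set g : X → OpenCone L := fun x => if x ∈ A then f x else G x
  have hgA : Set.EqOn g f A := fun x hx => if_pos hx
  have hgY : Set.EqOn g G Y := fun x hx => by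
    by_cases hxA : x ∈ A
    · rw [hgA hxA, hGF x ⟨hAN hxA, hx⟩, hFf hxA]
    · exact if_neg hxA
  obtain ⟨C₁, hC₁, hf₁⟩ := hf.asympLipschitzOn
  obtain ⟨C₂, hC₂, hG₂⟩ := hG.asympLipschitzOn
  obtain ⟨C₃, hC₃, hF₃⟩ := hF.asympLipschitzOn
  obtain ⟨C₄, hC₄, hψ₄⟩ := hψ
  set D : ℝ := C₁ + C₂ + C₃ + (C₄ + 2 * C) with hD
  have hD0 : 0 < D := by positivity
  have le_D : ∀ {c d : ℝ} {x y : X}, c ≤ D → d ≤ c * dist x y + c → d ≤ D * dist x y + D := by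
    intro c d x y hcD hd
    exact hd.trans (add_le_add (mul_le_mul_of_nonneg_right hcD dist_nonneg) hcD)
  have hmixed : ∀ a ∈ A, ∀ y ∈ Y, dist (g a) (g y) ≤ D * dist a y + D := by
    intro a ha y hy
    rw [hgA ha, hgY hy]
    by_cases hyN : y ∈ N
    · rw [hGF y ⟨hyN, hy⟩, ← hFf ha]
      exact le_D (by rw [hD]; linarith) (hF₃ a (hAN ha) y hyN)
    · have h1 := OpenCone.dist_le_height_add_height (f a) (G y)
      have h2 : (OpenCone.height (f a) : ℝ) ≤ ψ a := by
        rw [← hFf ha]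
        exact_mod_cast hFψ a (hAN ha)
      have h3 := hψ₄ a trivial y trivial
      rw [NNReal.dist_eq] at h3
      have h4 := le_abs_self ((ψ a : ℝ) - ψ y)
      have h5 := hψN y hyN
      have h6 : C * Metric.infDist y A ≤ C * dist a y := by
        rw [dist_comm]
        gcongr
        exact Metric.infDist_le_dist_of_mem ha
      refine le_D (c := C₄ + 2 * C) (by rw [hD]; linarith) ?_
      linarith [hGψ y]
  refine ⟨g, ⟨?_, ⟨D, hD0, ?_⟩, fun R => ?_⟩, hgA⟩
  · exact (hf.continuousOn.congr hgA).union_of_isClosed (hG.continuousOn.congr hgY) hA hY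
  · rintro x (hx | hx) y (hy | hy)
    · rw [hgA hx, hgA hy]
      exact le_D (by rw [hD]; linarith) (hf₁ x hx y hy)
    · exact hmixed x hx y hy
    · rw [dist_comm, dist_comm x]
      exact hmixed y hy x hx
    · rw [hgY hx, hgY hy]
      exact le_D (by rw [hD]; linarith) (hG₂ x hx y hy)
  · refine ((hf.isBounded R).union (hG.isBounded R)).subset ?_
    rintro x ⟨hx | hx, hxR⟩
    · exact Or.inl ⟨hx, by rwa [hgA hx] at hxR⟩
    · exact Or.inr ⟨hx, by rwa [hgY hx] at hxR⟩

end Adjoin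

/-! ### The finite sum theorem -/

theorem isProperMap_and_asympLipschitz_of_isEmpty {X L : Type*} [MetricSpace X] [IsEmpty X]
    [MetricSpace L] [DiamLEOne L] [CompactSpace L] (f : X → OpenCone L) :
    IsProperMap f ∧ AsympLipschitz f :=
  (isProperAsympLipschitzOn_univ_iff f).1
    ⟨fun x => isEmptyElim x, ⟨1, one_pos, fun x => isEmptyElim x⟩,
      fun _ => Bornology.IsBounded.subset Bornology.isBounded_empty fun x => isEmptyElim x⟩

/-- The extension property for the empty subset yields a map to the cone. -/
theorem AedLE.nonempty_openCone {X L : Type*} [MetricSpace X] [Nonempty X] [MetricSpace L]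
    [DiamLEOne L] [CompactSpace L] (h : AedLE X L) : Nonempty (OpenCone L) := by
  obtain ⟨hp, hl⟩ := isProperMap_and_asympLipschitz_of_isEmpty
    (isEmptyElim : (∅ : Set X) → OpenCone L)
  obtain ⟨g, -⟩ := h ∅ isClosed_empty _ hp hl
  exact ⟨g (Classical.arbitrary X)⟩

theorem mainTheorem2 {X : Type*} [MetricSpace X] [ProperSpace X]
    {L : Type*} [MetricSpace L] [DiamLEOne L] (hL : IsCompactALNER L)
    (X₁ X₂ : Set X) (hX₁ : IsClosed X₁) (hX₂ : IsClosed X₂) (hX : X₁ ∪ X₂ = Set.univ)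
    (h₁ : AedLE X₁ L) (h₂ : AedLE X₂ L) :
    AedLE X L := by
  classical
  have := hL.compact
  -- It suffices to extend from nonempty closed sets.
  have key : ∀ (A : Set X), IsClosed A → A.Nonempty → ∀ f : X → OpenCone L,
      IsProperAsympLipschitzOn f A →
        ∃ g : X → OpenCone L, IsProperMap g ∧ AsympLipschitz g ∧ Set.EqOn g f A := by
    intro A hA hne f hf
    obtain ⟨g₁, hg₁, hg₁A⟩ := hf.exists_extension_union hL hA hne hX₁ h₁
    obtain ⟨g₂, hg₂, hg₂A⟩ := hg₁.exists_extension_union hL (hA.union hX₁)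
      (hne.mono Set.subset_union_left) hX₂ h₂
    rw [Set.union_assoc, hX, Set.union_univ] at hg₂
    obtain ⟨hp, hl⟩ := (isProperAsympLipschitzOn_univ_iff g₂).1 hg₂
    exact ⟨g₂, hp, hl, fun a ha => (hg₂A (Or.inl ha)).trans (hg₁A ha)⟩
  intro A hA f hfp hfl
  rcases isEmpty_or_nonempty X with hXe | ⟨⟨x₀⟩⟩
  · obtain ⟨hp, hl⟩ := isProperMap_and_asympLipschitz_of_isEmpty (isEmptyElim : X → OpenCone L)
    exact ⟨isEmptyElim, hp, hl, fun a => isEmptyElim (a : X)⟩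
  obtain ⟨p₀⟩ : Nonempty (OpenCone L) := by
    rcases (hX.symm ▸ Set.mem_univ x₀ : x₀ ∈ X₁ ∪ X₂) with hx | hx
    · have : Nonempty X₁ := ⟨⟨x₀, hx⟩⟩
      exact h₁.nonempty_openCone
    · have : Nonempty X₂ := ⟨⟨x₀, hx⟩⟩
      exact h₂.nonempty_openCone
  set f' : X → OpenCone L := fun x => if hx : x ∈ A then f ⟨x, hx⟩ else p₀ with hf'
  have hf'A : f' ∘ ((↑) : A → X) = f := by
    ext a
    simp [hf']
  rcases A.eq_empty_or_nonempty with rfl | hne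
  · obtain ⟨g, hgp, hgl, -⟩ := key {x₀} isClosed_singleton (Set.singleton_nonempty x₀) f'
      ⟨continuousOn_singleton f' x₀, ⟨1, one_pos, by simp⟩,
        fun R => Bornology.isBounded_singleton.subset fun x hx => hx.1⟩
    exact ⟨g, hgp, hgl, fun a => a.2.elim⟩
  · have : ProperSpace A := .of_isClosed hA
    have hiff := (isometry_subtype_coe (s := A)).isProperAsympLipschitzOn_comp_iff f'
    rw [Subtype.range_coe, hf'A, isProperAsympLipschitzOn_univ_iff] at hiff
    obtain ⟨g, hgp, hgl, hgA⟩ := key A hA hne f' (hiff.1 ⟨hfp, hfl⟩)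
    exact ⟨g, hgp, hgl, fun a => (hgA a.2).trans (congrFun hf'A a)⟩
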